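/- **Heavy symmetric top (Lagrange–Poisson case).** Consider a rigid body with a fixed point $O$, principal moments of inertia $A=B>0$ and $C>0$ at $O$, mass $M>0$, and centre of mass at $(0,0,z_G)$, $z_G>0$, in the body frame, under gravity $g>0$ directed along the downward vertical. Let $\theta$ (nutation), $\varphi$ (spin), $\psi$ (precession) be the Euler angles of a motion on a time interval $J$, that is, with $$p=\dot\theta\cos\varphi+\dot\psi\sin\theta\sin\varphi,\quad q=-\dot\theta\sin\varphi+\dot\psi\sin\theta\cos\varphi,\quad r=\dot\varphi+\dot\psi\cos\theta,$$ $$\gamma_1=\sin\theta\sin\varphi,\quad \gamma_2=\sin\theta\cos\varphi,\quad \gamma_3=\cos\theta ,$$ such that Euler's equations hold on $J$: $$A\dot p=(A-C)qr+Mgz_G\gamma_2,\qquad A\dot q=(C-A)rp-Mgz_G\gamma_1,\qquad C\dot r=0 .$$ Let $E_0$, $K_{z,0}$, $r_0$ be the values at some time $\tau\in J$ of the energy $\frac12(Ap^2+Aq^2+Cr^2)+Mgz_G\gamma_3$, of the vertical angular momentum $Ap\gamma_1+Aq\gamma_2+Cr\gamma_3$, and of $r$. Put $$\hat\rho=\sqrt{\tfrac{2Mgz_G}{A}},\quad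 h=\frac{E_0}{Mgz_G},\quad c=\frac CA,\quad \hat k=\frac{K_{z,0}}{A\hat\rho},\quad \lambda=\frac{r_0}{\hat\rho},$$ $$f(s)=\hat\rho^2\left[(h-c\lambda^2)-s\right](1-s^2)-\hat\rho^2(\hat k-c\lambda s)^2 ,$$ and assume that the cubic $f$ has real roots $s_1,s_2,s_3$ with $-1<s_1<s_2<1<s_3$. Let $\mathrm F_D^{(n)}$ be the Lauricella function $$\mathrm F_D^{(n)}\!\left(a;b_1,\dots,b_n;c\,|\,x_1,\dots,x_n\right)=\sum_{m_1,\dots,m_n\ge 0}\frac{(a)_{m_1+\cdots+m_n}(b_1)_{m_1}\cdots(b_n)_{m_n}}{(c)_{m_1+\cdots+m_n}\,m_1!\cdots m_n!}\,x_1^{m_1}\cdots x_n^{m_n}\qquad(|x_i|<1),$$ continued real-analytically to $(-\infty,1)^n$, and for $s_1\le s<s_2$ put $$\Xi(s)=\mathrm F_D^{(4)}\!\left(\tfrac12;1,1,\tfrac12,\tfrac12;\tfrac32\,\Big|\,X(s)\right),\qquad \Lambda(s)=\mathrm F_D^{(4)}\!\left(\tfrac32;1,1,\tfrac12,\tfrac12;\tfrac52\,\Big|\,X(s)\right),$$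 $$X(s)=\left(\frac{s-s_1}{1-s_1},\,-\frac{s-s_1}{1+s_1},\,-\frac{s-s_1}{s_1-s_3},\,-\frac{s-s_1}{s_1-s_2}\right),$$ $$\Psi_{\kappa,\beta}(s)=\frac{2\sqrt{s-s_1}}{(1-s_1^2)\sqrt{(s_3-s_1)(s_2-s_1)}}\left[(\kappa-\beta s_1)\,\Xi(s)-\frac{\beta}{3}(s-s_1)\,\Lambda(s)\right].$$ Then: 1. For all real $\alpha$ and all $s_1\le y<s_2$ the following integral converges absolutely and $$\int_{s_1}^{y}\frac{1-\alpha s}{(1-s^2)\sqrt{(s-s_1)(s-s_2)(s-s_3)}}\,\mathrm ds=\Psi_{1,\alpha}(y).$$ 2. If $t_0\le t$ lie in $J$, $\cos\theta$ is nondecreasing on $[t_0,t]$, $\cos\theta(t_0)=s_1$ and $\cos\theta(t)<s_2$, then, with $\psi_0=\psi(t_0)$ and $\theta=\theta(t)$, $$\psi(t)-\psi_0=\frac{2\sqrt{\cos\theta-s_1}}{(1-s_1^2)\sqrt{(s_3-s_1)(s_2-s_1)}}\left[(\hat k-c\lambda s_1)\,\Xi(\cos\theta)-\frac{c\lambda}{3}(\cos\theta-s_1)\,\Lambda(\cos\theta)\right].$$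 (If $\hat k\ne0$, this is $\hat k$ times the value of $\Psi_{1,\alpha}(\cos\theta)$ for $\alpha=c\lambda/\hat k$.) 3. More generally, let $t_0\le t$ lie in $J$. If $\cos\theta$ is nondecreasing on $[t_0,t]$ and $\cos\theta(t)<s_2$, then $\psi(t)-\psi(t_0)=\Psi_{\hat k,c\lambda}(\cos\theta(t))-\Psi_{\hat k,c\lambda}(\cos\theta(t_0))$. If $\cos\theta$ is nonincreasing on $[t_0,t]$ and $\cos\theta(t_0)<s_2$, then $\psi(t)-\psi(t_0)=-\left[\Psi_{\hat k,c\lambda}(\cos\theta(t))-\Psi_{\hat k,c\lambda}(\cos\theta(t_0))\right]$. -/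

import Mathlib

/-! ### The Lauricella function `F_D` -/

/-- The general term of the Lauricella series `F_D^{(n)}(a; b₁, …, bₙ; c | x₁, …, xₙ)`. -/
noncomputable def lauricellaTerm {n : ℕ} (a : ℝ) (b : Fin n → ℝ) (c : ℝ) (x : Fin n → ℝ)
    (m : Fin n → ℕ) : ℝ :=
  ((ascPochhammer ℝ (∑ i, m i)).eval a * ∏ i, (ascPochhammer ℝ (m i)).eval (b i)) /
    ((ascPochhammer ℝ (∑ i, m i)).eval c * ∏ i, ((m i).factorial : ℝ)) * ∏ i, x i ^ m i

/-- The real domain `(-∞, 1)ⁿ` to which the Lauricella function is continued analytically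
(the real points of `(ℂ ∖ [1, ∞))ⁿ`). -/
def lauricellaDomain (n : ℕ) : Set (Fin n → ℝ) := {x | ∀ i, x i < 1}

/-- `F` is the Lauricella function with the given parameters: it is the sum of the Lauricella
series on `|x₁| < 1, …, |xₙ| < 1` and it is real analytic on `(-∞, 1)ⁿ`. -/
structure IsLauricellaFD {n : ℕ} (a : ℝ) (b : Fin n → ℝ) (c : ℝ)
    (F : (Fin n → ℝ) → ℝ) : Prop where
  analytic : AnalyticOnNhd ℝ F (lauricellaDomain n)
  hasSum : ∀ x : Fin n → ℝ, (∀ i, |x i| < 1) → HasSum (lauricellaTerm a b c x) (F x)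

/-- The analytic continuation is unique, so that `lauricellaFD` below is well determined on
`(-∞, 1)ⁿ`. -/
theorem IsLauricellaFD.eqOn {n : ℕ} {a : ℝ} {b : Fin n → ℝ} {c : ℝ} {F G : (Fin n → ℝ) → ℝ}
    (hF : IsLauricellaFD a b c F) (hG : IsLauricellaFD a b c G) :
    Set.EqOn F G (lauricellaDomain n) := by
  have hconv : Convex ℝ (lauricellaDomain n) := by
    have h : lauricellaDomain n = Set.univ.pi fun _ : Fin n => Set.Iio (1 : ℝ) := by
      ext x
      simp [lauricellaDomain]
    rw [h]
    exact convex_pi fun i _ => convex_Iio 1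
  refine hF.analytic.eqOn_of_preconnected_of_eventuallyEq hG.analytic hconv.isPreconnected
    (z₀ := 0) (by simp [lauricellaDomain]) ?_
  filter_upwards [Metric.ball_mem_nhds (0 : Fin n → ℝ) one_pos] with x hx
  have hx' : ∀ i, |x i| < 1 := fun i =>
    lt_of_le_of_lt (norm_le_pi_norm x i) (mem_ball_zero_iff.mp hx)
  exact (hF.hasSum x hx').unique (hG.hasSum x hx')

open Classical in
/-- The Lauricella function `F_D^{(n)}(a; b₁, …, bₙ; c | x₁, …, xₙ)` of real variables `xᵢ < 1`:
the sum of the Lauricella series, continued analytically from `(-1, 1)ⁿ` to `(-∞, 1)ⁿ`. -/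
noncomputable def lauricellaFD {n : ℕ} (a : ℝ) (b : Fin n → ℝ) (c : ℝ) (x : Fin n → ℝ) : ℝ :=
  if h : ∃ F : (Fin n → ℝ) → ℝ, IsLauricellaFD a b c F then h.choose x else 0

/-! ### The heavy symmetric top -/

/-- A heavy symmetric top: principal moments of inertia `A = B` and `C` at the fixed point, mass
`M`, gravitational acceleration `g`, and centre of mass at `(0, 0, zG)` in the body frame. -/
structure HeavySymmetricTop where
  A : ℝ
  C : ℝ
  M : ℝ
  g : ℝ
  zG : ℝ
  A_pos : 0 < A
  C_pos : 0 < C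
  M_pos : 0 < M
  g_pos : 0 < g
  zG_pos : 0 < zG

/-- The Euler angles (nutation `θ`, spin `φ`, precession `ψ`) as functions of time, together with
functions `θ'`, `φ'`, `ψ'` that serve as their time derivatives. -/
structure EulerAngles where
  θ : ℝ → ℝ
  φ : ℝ → ℝ
  ψ : ℝ → ℝ
  θ' : ℝ → ℝ
  φ' : ℝ → ℝ
  ψ' : ℝ → ℝ

namespace EulerAngles

/-- First body component of the angular velocity. -/
noncomputable def p (e : EulerAngles) (t : ℝ) : ℝ :=
  e.θ' t * Real.cos (e.φ t) + e.ψ' t * Real.sin (e.θ t) * Real.sin (e.φ t)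

/-- Second body component of the angular velocity. -/
noncomputable def q (e : EulerAngles) (t : ℝ) : ℝ :=
  -(e.θ' t * Real.sin (e.φ t)) + e.ψ' t * Real.sin (e.θ t) * Real.cos (e.φ t)

/-- Third body component of the angular velocity. -/
noncomputable def r (e : EulerAngles) (t : ℝ) : ℝ :=
  e.φ' t + e.ψ' t * Real.cos (e.θ t)

/-- First direction cosine of the upward vertical with respect to the body frame. -/
noncomputable def γ₁ (e : EulerAngles) (t : ℝ) : ℝ := Real.sin (e.θ t) * Real.sin (e.φ t)

/-- Second direction cosine of the upward vertical with respect to the body frame. -/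
noncomputable def γ₂ (e : EulerAngles) (t : ℝ) : ℝ := Real.sin (e.θ t) * Real.cos (e.φ t)

/-- Third direction cosine of the upward vertical with respect to the body frame. -/
noncomputable def γ₃ (e : EulerAngles) (t : ℝ) : ℝ := Real.cos (e.θ t)

end EulerAngles

namespace HeavySymmetricTop

/-- The Euler angles `e` describe a motion of the top `T` during the time interval `J`: Euler's
dynamical equations hold, the torque being that of the weight, which acts along the
downward vertical in the centre of mass. -/
structure IsMotion (T : HeavySymmetricTop) (J : Set ℝ) (e : EulerAngles) : Prop where
  hasDeriv_θ : ∀ t ∈ J, HasDerivWithinAt e.θ (e.θ' t) J t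
  hasDeriv_φ : ∀ t ∈ J, HasDerivWithinAt e.φ (e.φ' t) J t
  hasDeriv_ψ : ∀ t ∈ J, HasDerivWithinAt e.ψ (e.ψ' t) J t
  euler_p : ∀ t ∈ J, HasDerivWithinAt e.p
    (((T.A - T.C) * e.q t * e.r t + T.M * T.g * T.zG * e.γ₂ t) / T.A) J t
  euler_q : ∀ t ∈ J, HasDerivWithinAt e.q
    (((T.C - T.A) * e.r t * e.p t - T.M * T.g * T.zG * e.γ₁ t) / T.A) J t
  euler_r : ∀ t ∈ J, HasDerivWithinAt e.r 0 J t

/-- Total energy at time `t`. -/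
noncomputable def energy (T : HeavySymmetricTop) (e : EulerAngles) (t : ℝ) : ℝ :=
  (T.A * e.p t ^ 2 + T.A * e.q t ^ 2 + T.C * e.r t ^ 2) / 2 + T.M * T.g * T.zG * e.γ₃ t

/-- Vertical component of the moment of momentum at time `t`. -/
noncomputable def verticalMomentum (T : HeavySymmetricTop) (e : EulerAngles) (t : ℝ) : ℝ :=
  T.A * e.p t * e.γ₁ t + T.A * e.q t * e.γ₂ t + T.C * e.r t * e.γ₃ t

/-- `ρ̂ = √(2 M g z_G / A)`. -/
noncomputable def rhoHat (T : HeavySymmetricTop) : ℝ := Real.sqrt (2 * (T.M * T.g * T.zG / T.A))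

/-- `h = E₀ / (M g z_G)`. -/
noncomputable def hConst (T : HeavySymmetricTop) (E₀ : ℝ) : ℝ := E₀ / (T.M * T.g * T.zG)

/-- `c = C / A`. -/
noncomputable def cConst (T : HeavySymmetricTop) : ℝ := T.C / T.A

/-- `k̂ = K_{z,0} / (A ρ̂)`. -/
noncomputable def kHat (T : HeavySymmetricTop) (K₀ : ℝ) : ℝ := K₀ / (T.A * T.rhoHat)

/-- `λ = r₀ / ρ̂`. -/
noncomputable def lam (T : HeavySymmetricTop) (r₀ : ℝ) : ℝ := r₀ / T.rhoHat

/-- The resolvent cubic `f(s) = ρ̂² ((h - c λ²) - s) (1 - s²) - ρ̂² (k̂ - c λ s)²`. -/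
noncomputable def resolvent (T : HeavySymmetricTop) (E₀ K₀ r₀ s : ℝ) : ℝ :=
  T.rhoHat ^ 2 * ((T.hConst E₀ - T.cConst * T.lam r₀ ^ 2) - s) * (1 - s ^ 2) -
    T.rhoHat ^ 2 * (T.kHat K₀ - T.cConst * T.lam r₀ * s) ^ 2

end HeavySymmetricTop

/-! ### The closed form -/

/-- The four arguments of the Lauricella functions `Ξ` and `Λ`, at `s = cos θ`. -/
noncomputable def lauricellaArgs (s₁ s₂ s₃ s : ℝ) : Fin 4 → ℝ :=
  ![(s - s₁) / (1 - s₁), -((s - s₁) / (1 + s₁)), -((s - s₁) / (s₁ - s₃)), -((s - s₁) / (s₁ - s₂))]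

/-- `Ξ = F_D^{(4)}(1/2; 1, 1, 1/2, 1/2; 3/2 | …)`. -/
noncomputable def lauricellaXi (s₁ s₂ s₃ s : ℝ) : ℝ :=
  lauricellaFD (1 / 2) ![1, 1, 1 / 2, 1 / 2] (3 / 2) (lauricellaArgs s₁ s₂ s₃ s)

/-- `Λ = F_D^{(4)}(3/2; 1, 1, 1/2, 1/2; 5/2 | …)`. -/
noncomputable def lauricellaLambda (s₁ s₂ s₃ s : ℝ) : ℝ :=
  lauricellaFD (3 / 2) ![1, 1, 1 / 2, 1 / 2] (5 / 2) (lauricellaArgs s₁ s₂ s₃ s)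

/-- The closed form
`2 √(s - s₁) / ((1 - s₁²) √((s₃ - s₁)(s₂ - s₁))) · [(κ - β s₁) Ξ - (β / 3) (s - s₁) Λ]`. -/
noncomputable def precessionForm (s₁ s₂ s₃ κ β s : ℝ) : ℝ :=
  2 * Real.sqrt (s - s₁) / ((1 - s₁ ^ 2) * Real.sqrt ((s₃ - s₁) * (s₂ - s₁))) *
    ((κ - β * s₁) * lauricellaXi s₁ s₂ s₃ s - β / 3 * (s - s₁) * lauricellaLambda s₁ s₂ s₃ s)

/-! Put `u = cos θ`. Conservation of energy, vertical momentum and `r` gives `u'² = ρ̂² (u - s₁)(u -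
s₂)(u - s₃)` and `ψ' (1 - u²) = ρ̂ (k̂ - c λ u)`. Where `u` is monotone, `ψ` therefore changes by
`±` the increment of a primitive of `precessionKernel` along `u`.

The primitive starting at `s₁` is computed by `s = s₁ + (y - s₁) t`, which turns every linear factor
into a constant times `t` or `1 - xᵢ t`. What remains are Euler integrals with `a = 1/2` and `a =
3/2`. These are values of `lauricellaFD`, since its continuation is unique and Euler's integral has
both defining properties: it sums the series (termwise integration), and it is analytic, being a
composite of an affine map into the Banach algebra `C([0,1])`, analytic power maps, a product and a
continuous linear functional.

The kernel blows up at the turning point `s₁`, so the dynamical step (`ψ_sub_eq`) uses the mean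
value theorem, which needs only continuity at the ends of the time interval. Inside it `u > s₁`:
otherwise monotonicity would keep `u` at `s₁` for some time, while `u'' > 0` there
(`not_forall_eq`). This needs the equation for `u''`, because the one for `u'²` also admits the
constant solution `s₁`. -/

theorem FormalMultilinearSeries.radius_le_radius_ofScalars {𝔸 : Type*} [NormedRing 𝔸]
    [NormedAlgebra ℝ 𝔸] [NormOneClass 𝔸] (c : ℕ → ℝ) :
    (ofScalars ℝ c).radius ≤ (ofScalars 𝔸 c).radius := by
  refine ENNReal.le_of_forall_nnreal_lt fun r hr => ?_
  obtain ⟨C, _, hC⟩ := (ofScalars ℝ c).norm_mul_pow_le_of_lt_radius hr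
  exact (ofScalars 𝔸 c).le_radius_of_bound C fun n => by simpa using hC n

/-- Evaluation at `t` is continuous, linear and multiplicative, so it passes through the power
series. -/
theorem ContinuousMap.ofScalars_sum_apply {K : Type*} [TopologicalSpace K] [CompactSpace K]
    [Nonempty K] (c : ℕ → ℝ) (f : C(K, ℝ))
    (hf : f ∈ Metric.eball 0 (FormalMultilinearSeries.ofScalars C(K, ℝ) c).radius) (t : K) :
    (FormalMultilinearSeries.ofScalars C(K, ℝ) c).sum f t =
      (FormalMultilinearSeries.ofScalars ℝ c).sum (f t) := by
  have h := (FormalMultilinearSeries.ofScalars C(K, ℝ) c).hasSum hf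
  have h' := h.mapL (ContinuousMap.evalCLM ℝ t)
  have h2 := h'.tsum_eq
  rw [ContinuousMap.evalCLM_apply] at h2
  rw [← h2, FormalMultilinearSeries.sum]
  refine tsum_congr fun n => ?_
  simp [FormalMultilinearSeries.ofScalars_apply_eq, mul_comm]

/-- Near a positive function, the power map on the Banach algebra of continuous functions on
a compact space is real analytic. -/
theorem ContinuousMap.exists_analyticAt_rpow {K : Type*} [TopologicalSpace K] [CompactSpace K]
    [Nonempty K] (p : ℝ) (f₀ : C(K, ℝ)) (hf₀ : ∀ t, 0 < f₀ t) :
    ∃ G : C(K, ℝ) → C(K, ℝ), AnalyticAt ℝ G f₀ ∧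
      ∀ᶠ f in nhds f₀, ∀ t, G f t = f t ^ p := by
  let B := binomialSeries C(K, ℝ) p
  have hB : 1 ≤ B.radius :=
    (binomialSeries_radius_ge_one (𝕂 := ℝ) (𝔸 := ℝ) (a := p)).trans
      (FormalMultilinearSeries.radius_le_radius_ofScalars _)
  -- Write `f = f₀ (1 + φ f)` with `φ f = (f - f₀) / f₀`; then `f ^ p = f₀ ^ p (1 + φ f) ^ p`, and
  -- the second factor is a binomial series once `‖φ f‖ < 1`.
  let w : C(K, ℝ) := ⟨fun t => f₀ t ^ p, f₀.continuous.rpow_const fun t => Or.inl (hf₀ t).ne'⟩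
  let v : C(K, ℝ) := ⟨fun t => (f₀ t)⁻¹, f₀.continuous.inv₀ fun t => (hf₀ t).ne'⟩
  let φ : C(K, ℝ) → C(K, ℝ) := fun f => (f - f₀) * v
  have hφ : Continuous φ := by fun_prop
  have hφ0 : φ f₀ = 0 := by simp [φ]
  have hBan : AnalyticAt ℝ B.sum (φ f₀) := by
    rw [hφ0]
    exact (B.hasFPowerSeriesOnBall (zero_lt_one.trans_le hB)).analyticAt
  refine ⟨fun f => w * B.sum (φ f), ?_, ?_⟩
  · refine analyticAt_const.mul (hBan.comp (f := φ) ?_)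
    exact (analyticAt_id.sub analyticAt_const).mul analyticAt_const
  · have hev : ∀ᶠ f in nhds f₀, φ f ∈ Metric.ball (0 : C(K, ℝ)) 1 :=
      hφ.continuousAt.eventually (by rw [hφ0]; exact Metric.ball_mem_nhds 0 one_pos)
    filter_upwards [hev] with f hf t
    have hf' : φ f ∈ Metric.eball (0 : C(K, ℝ)) B.radius := by
      refine Metric.eball_subset_eball hB ?_
      rw [← ENNReal.ofReal_one, Metric.eball_ofReal]
      exact hf
    have hft : |φ f t| < 1 :=
      lt_of_le_of_lt ((φ f).norm_coe_le_norm t) (by simpa using hf)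
    have hsum : B.sum (φ f) t = (1 + φ f t) ^ p := by
      refine (ContinuousMap.ofScalars_sum_apply _ _ hf' t).trans ?_
      refine (Real.one_add_rpow_hasFPowerSeriesOnBall_zero (a := p)).sum ?_ |>.symm.trans ?_
      · rw [← ENNReal.ofReal_one, Metric.eball_ofReal]
        simpa using hft
      · simp
    have h1 : 0 ≤ 1 + φ f t := by linarith [(abs_lt.mp hft).1]
    have h2 : f₀ t * (1 + φ f t) = f t := by
      have := (hf₀ t).ne'
      simp only [φ, v, ContinuousMap.mul_apply, ContinuousMap.sub_apply, ContinuousMap.coe_mk]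
      field_simp
      ring
    rw [ContinuousMap.mul_apply, hsum, ← h2, Real.mul_rpow (hf₀ t).le h1]
    rfl

/-! ### Euler's integral for the Lauricella function -/

theorem HasSum.mul_prod_real {α β : Type*} {f : α → ℝ} {g : β → ℝ} {s t : ℝ}
    (hf : HasSum f s) (hg : HasSum g t) :
    HasSum (fun p : α × β => f p.1 * g p.2) (s * t) :=
  hf.mul hg (summable_mul_of_summable_norm hf.summable.norm hg.summable.norm)

theorem hasSum_prod_pi {n : ℕ} {f : Fin n → ℕ → ℝ} {s : Fin n → ℝ}
    (h : ∀ i, HasSum (f i) (s i)) :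
    HasSum (fun m : Fin n → ℕ => ∏ i, f i (m i)) (∏ i, s i) := by
  induction n with
  | zero => simp
  | succ n ih =>
    have h1 := ih fun i => h i.succ
    have h2 := (h 0).mul_prod_real h1
    let E : ℕ × (Fin n → ℕ) ≃ (Fin (n + 1) → ℕ) := Fin.consEquiv fun _ => ℕ
    refine (E.hasSum_iff (f := fun m : Fin (n + 1) → ℕ => ∏ i, f i (m i))).mp ?_
    rw [Fin.prod_univ_succ]
    refine h2.congr_fun fun m => ?_
    simp [E, Fin.consEquiv, Fin.prod_univ_succ]

theorem hasSum_ascPochhammer_rpow (b : ℝ) {z : ℝ} (hz : |z| < 1) :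
    HasSum (fun m : ℕ => (ascPochhammer ℝ m).eval b / m.factorial * z ^ m) ((1 - z) ^ (-b)) := by
  have h := (Real.one_div_one_sub_rpow_hasFPowerSeriesOnBall_zero b).hasSum (y := z) (by
    rw [← ENNReal.ofReal_one, Metric.eball_ofReal]; simpa using hz)
  have hpos : 0 ≤ 1 - z := by linarith [(abs_lt.mp hz).2]
  rw [zero_add, one_div, ← Real.rpow_neg hpos] at h
  refine h.congr_fun fun m => ?_
  rw [FormalMultilinearSeries.ofScalars_apply_eq, smul_eq_mul]
  congr 1
  rw [Ring.choose_eq_smul, Polynomial.descPochhammer_smeval_eq_ascPochhammer,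
    Polynomial.ascPochhammer_smeval_eq_eval, smul_eq_mul, div_eq_inv_mul]
  congr 2
  ring

/-- Euler's integral `a ∫₀¹ t^(a-1) ∏ᵢ (1 - xᵢ t)^(-bᵢ) dt`. -/
noncomputable def lauricellaEulerIntegral {n : ℕ} (a : ℝ) (b x : Fin n → ℝ) : ℝ :=
  a * ∫ t in (0 : ℝ)..1, t ^ (a - 1) * ∏ i, (1 - x i * t) ^ (-b i)

theorem one_sub_mul_pos {x t : ℝ} (hx : x < 1) (h0 : 0 ≤ t) (h1 : t ≤ 1) : 0 < 1 - x * t := by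
  nlinarith [mul_nonneg h0 (sub_nonneg.mpr hx.le)]

theorem ascPochhammer_eval_succ_mul {a : ℝ} (N : ℕ) :
    (ascPochhammer ℝ N).eval (a + 1) * a = (ascPochhammer ℝ N).eval a * (a + N) := by
  have h1 := congrArg (Polynomial.eval a) (ascPochhammer_succ_left ℝ N)
  rw [ascPochhammer_succ_right] at h1
  simp at h1
  linarith

/-- For lower parameter `a + 1` the quotient `(a)_N / (a + 1)_N` collapses to `a / (a + N)`, which
is `a` times the integral of `t ^ (a - 1 + N)`. -/
theorem lauricellaTerm_eq {n : ℕ} {a : ℝ} (ha : 0 < a) (b x : Fin n → ℝ) (m : Fin n → ℕ) :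
    lauricellaTerm a b (a + 1) x m =
      a * ((∏ i, (ascPochhammer ℝ (m i)).eval (b i) / (m i).factorial * x i ^ m i) *
        ∫ t in (0 : ℝ)..1, t ^ (a - 1 + (∑ i, m i : ℕ))) := by
  have hN : (0 : ℝ) ≤ (∑ i, m i : ℕ) := Nat.cast_nonneg _
  have h1 := ascPochhammer_eval_succ_mul (a := a) (∑ i, m i)
  have h2 : (ascPochhammer ℝ (∑ i, m i)).eval (a + 1) ≠ 0 :=
    (ascPochhammer_pos _ _ (by linarith)).ne'
  have h3 : (∏ i, ((m i).factorial : ℝ)) ≠ 0 :=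
    Finset.prod_ne_zero_iff.mpr fun i _ => Nat.cast_ne_zero.mpr (m i).factorial_ne_zero
  have h4 : a - 1 + (∑ i, m i : ℕ) + 1 = a + (∑ i, m i : ℕ) := by ring
  have h5 : a + (∑ i, m i : ℕ) ≠ 0 := by linarith
  rw [integral_rpow (Or.inl (by linarith)), Real.one_rpow, h4, Real.zero_rpow h5,
    lauricellaTerm, Finset.prod_mul_distrib, Finset.prod_div_distrib]
  generalize ((∑ i, m i : ℕ) : ℝ) = N at *
  field_simp
  linear_combination -((∏ i, Polynomial.eval (b i) (ascPochhammer ℝ (m i))) * ∏ i, x i ^ m i) * h1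

/-- Termwise integration of a product of power series against an integrable weight. -/
theorem hasSum_integral_mul_prod {n : ℕ} {w : ℝ → ℝ}
    (hw : IntervalIntegrable w MeasureTheory.volume 0 1) {c : Fin n → ℕ → ℝ} {x : Fin n → ℝ}
    {g : Fin n → ℝ → ℝ} (hc : ∀ i, Summable fun m => c i m * x i ^ m)
    (hg : ∀ i, ∀ t ∈ Set.Ioc (0 : ℝ) 1, HasSum (fun m => c i m * (x i * t) ^ m) (g i t)) :
    HasSum (fun m : Fin n → ℕ => ∫ t in (0 : ℝ)..1, w t * ∏ i, c i (m i) * (x i * t) ^ m i)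
      (∫ t in (0 : ℝ)..1, w t * ∏ i, g i t) := by
  have habs : Summable fun m : Fin n → ℕ => ∏ i, |c i (m i) * x i ^ m i| :=
    (hasSum_prod_pi fun i => (hc i).abs.hasSum).summable
  -- Each term is dominated by replacing the power-series factors by their absolute values at `t =
  -- 1`.
  refine intervalIntegral.hasSum_integral_of_dominated_convergence
    (fun m t => |w t| * ∏ i, |c i (m i) * x i ^ m i|) ?_ ?_ ?_ ?_ ?_
  · exact fun m => (hw.mul_continuousOn (by fun_prop)).def'.aestronglyMeasurable
  · refine fun m => Filter.Eventually.of_forall fun t ht => ?_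
    rw [Set.uIoc_of_le zero_le_one] at ht
    rw [Real.norm_eq_abs, abs_mul, Finset.abs_prod]
    refine mul_le_mul_of_nonneg_left ?_ (abs_nonneg _)
    refine Finset.prod_le_prod (fun _ _ => abs_nonneg _) fun i _ => ?_
    rw [mul_pow, ← mul_assoc, abs_mul, abs_of_nonneg (pow_nonneg ht.1.le _)]
    exact mul_le_of_le_one_right (abs_nonneg _) (pow_le_one₀ ht.1.le ht.2)
  · exact Filter.Eventually.of_forall fun t _ => habs.mul_left _
  · simp_rw [tsum_mul_left]
    exact hw.abs.mul_const _
  · refine Filter.Eventually.of_forall fun t ht => ?_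
    rw [Set.uIoc_of_le zero_le_one] at ht
    exact (hasSum_prod_pi fun i => hg i t ht).mul_left _

theorem hasSum_lauricellaEulerIntegral {n : ℕ} {a : ℝ} (ha : 0 < a) (b : Fin n → ℝ)
    {x : Fin n → ℝ} (hx : ∀ i, |x i| < 1) :
    HasSum (lauricellaTerm a b (a + 1) x) (lauricellaEulerIntegral a b x) := by
  have hw : IntervalIntegrable (fun t : ℝ => t ^ (a - 1)) MeasureTheory.volume 0 1 :=
    intervalIntegral.intervalIntegrable_rpow' (by linarith)
  have key := hasSum_integral_mul_prod (n := n) hw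
    (fun i => (hasSum_ascPochhammer_rpow (b i) (hx i)).summable) fun i t ht =>
      hasSum_ascPochhammer_rpow (b i) (z := x i * t) (by
        rw [abs_mul, abs_of_pos ht.1]
        exact lt_of_le_of_lt (mul_le_of_le_one_right (abs_nonneg _) ht.2) (hx i))
  refine (key.mul_left a).congr_fun fun m => ?_
  rw [lauricellaTerm_eq ha b x m, ← intervalIntegral.integral_const_mul]
  congr 1
  refine intervalIntegral.integral_congr_ae (Filter.Eventually.of_forall fun t ht => ?_)
  rw [Set.uIoc_of_le zero_le_one] at ht
  rw [Real.rpow_add_natCast ht.1.ne', ← Finset.prod_pow_eq_pow_sum, mul_left_comm,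
    ← Finset.prod_mul_distrib]
  simp only [mul_pow, mul_assoc]

/-- Integration against an integrable weight, on continuous functions on the unit interval. -/
theorem exists_clm_weighted_integral {w : ℝ → ℝ}
    (hw : IntervalIntegrable w MeasureTheory.volume 0 1) :
    ∃ I : C(Set.Icc (0 : ℝ) 1, ℝ) →L[ℝ] ℝ, ∀ f : C(Set.Icc (0 : ℝ) 1, ℝ),
      I f = ∫ t in (0 : ℝ)..1, w t * f (Set.projIcc 0 1 zero_le_one t) := by
  have hint : ∀ f : C(Set.Icc (0 : ℝ) 1, ℝ), IntervalIntegrable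
      (fun t => w t * f (Set.projIcc 0 1 zero_le_one t)) MeasureTheory.volume 0 1 := fun f =>
    hw.mul_continuousOn (f.continuous.comp continuous_projIcc).continuousOn
  let I₀ : C(Set.Icc (0 : ℝ) 1, ℝ) →ₗ[ℝ] ℝ :=
    { toFun := fun f => ∫ t in (0 : ℝ)..1, w t * f (Set.projIcc 0 1 zero_le_one t)
      map_add' := fun f g => by
        rw [← intervalIntegral.integral_add (hint f) (hint g)]
        simp [mul_add]
      map_smul' := fun r f => by
        rw [RingHom.id_apply, smul_eq_mul, ← intervalIntegral.integral_const_mul]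
        simp [mul_left_comm] }
  refine ⟨I₀.mkContinuous (∫ t in (0 : ℝ)..1, |w t|) fun f => ?_, fun f => rfl⟩
  rw [← intervalIntegral.integral_mul_const]
  refine intervalIntegral.norm_integral_le_of_norm_le zero_le_one
    (Filter.Eventually.of_forall fun t _ => ?_) (hw.abs.mul_const _)
  rw [norm_mul, Real.norm_eq_abs (w t)]
  exact mul_le_mul_of_nonneg_left (f.norm_coe_le_norm _) (abs_nonneg _)

theorem analyticOnNhd_lauricellaEulerIntegral {n : ℕ} {a : ℝ} (ha : 0 < a) (b : Fin n → ℝ) :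
    AnalyticOnNhd ℝ (lauricellaEulerIntegral a b) (lauricellaDomain n) := by
  intro x₀ hx₀
  obtain ⟨I, hI⟩ := exists_clm_weighted_integral
    (intervalIntegral.intervalIntegrable_rpow' (a := 0) (b := 1) (r := a - 1) (by linarith))
  let v : C(Set.Icc (0 : ℝ) 1, ℝ) := ⟨fun t => t, continuous_subtype_val⟩
  let φ : Fin n → (Fin n → ℝ) → C(Set.Icc (0 : ℝ) 1, ℝ) := fun i x => 1 - x i • v
  have hφ : ∀ i, AnalyticAt ℝ (φ i) x₀ := fun i =>
    analyticAt_const.sub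
      (((ContinuousLinearMap.proj (R := ℝ) (φ := fun _ : Fin n => ℝ) i).analyticAt x₀).smul
        analyticAt_const)
  have hpos : ∀ i t, 0 < φ i x₀ t := fun i t => by
    simpa [φ, v] using one_sub_mul_pos (hx₀ i) t.2.1 t.2.2
  choose G hG hGe using fun i => ContinuousMap.exists_analyticAt_rpow (-b i) (φ i x₀) (hpos i)
  have hprod : AnalyticAt ℝ (fun x => ∏ i, G i (φ i x)) x₀ :=
    Finset.univ.analyticAt_fun_prod fun i _ => (hG i).comp (hφ i)
  have han : AnalyticAt ℝ (fun x => a * I (∏ i, G i (φ i x))) x₀ :=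
    analyticAt_const.mul ((I.analyticAt _).comp hprod)
  refine han.congr ?_
  -- `G i` is known to be the power map only near `φ i x₀`, which suffices for analyticity at `x₀`.
  have hev : ∀ᶠ x in nhds x₀, ∀ i t, G i (φ i x) t = φ i x t ^ (-b i) :=
    Filter.eventually_all.mpr fun i => (hφ i).continuousAt.eventually (hGe i)
  filter_upwards [hev] with x hx
  rw [hI, lauricellaEulerIntegral]
  congr 1
  refine intervalIntegral.integral_congr fun t ht => ?_
  rw [Set.uIcc_of_le zero_le_one] at ht
  simp only [ContinuousMap.prod_apply, hx]
  simp [φ, v, Set.projIcc_of_mem zero_le_one ht]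

theorem isLauricellaFD_eulerIntegral {n : ℕ} {a : ℝ} (ha : 0 < a) (b : Fin n → ℝ) :
    IsLauricellaFD a b (a + 1) (lauricellaEulerIntegral a b) :=
  ⟨analyticOnNhd_lauricellaEulerIntegral ha b, fun _ hx => hasSum_lauricellaEulerIntegral ha b hx⟩

theorem lauricellaFD_eq_eulerIntegral {n : ℕ} {a : ℝ} (ha : 0 < a) (b : Fin n → ℝ)
    {x : Fin n → ℝ} (hx : ∀ i, x i < 1) :
    lauricellaFD a b (a + 1) x = lauricellaEulerIntegral a b x := by
  have h : ∃ F, IsLauricellaFD a b (a + 1) F := ⟨_, isLauricellaFD_eulerIntegral ha b⟩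
  rw [lauricellaFD, dif_pos h]
  exact h.choose_spec.eqOn (isLauricellaFD_eulerIntegral ha b) hx

/-! ### The quadrature in closed form -/

/-- The quadrature integrand `(κ - β s) / ((1 - s²) √((s - s₁)(s - s₂)(s - s₃)))`. -/
noncomputable def precessionKernel (s₁ s₂ s₃ κ β s : ℝ) : ℝ :=
  (κ - β * s) / ((1 - s ^ 2) * Real.sqrt ((s - s₁) * (s - s₂) * (s - s₃)))

/-- Isolates the integrable singularity at `s₁`; the other factor is continuous on `[s₁, y]` for `y
< s₂`. -/
theorem precessionKernel_eq_rpow_mul {s₁ s₂ s₃ s : ℝ} (κ β : ℝ) (h : s₁ ≤ s) :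
    precessionKernel s₁ s₂ s₃ κ β s = (s - s₁) ^ (-(1 / 2) : ℝ) *
      ((κ - β * s) / ((1 - s ^ 2) * Real.sqrt ((s - s₂) * (s - s₃)))) := by
  rw [precessionKernel, mul_assoc (s - s₁), Real.sqrt_mul (sub_nonneg.mpr h),
    Real.rpow_neg (sub_nonneg.mpr h), ← Real.sqrt_eq_rpow, mul_left_comm, div_mul_eq_div_div_swap,
    div_eq_inv_mul]

theorem intervalIntegrable_precessionKernel {s₁ s₂ s₃ y : ℝ} (κ β : ℝ) (h₀₁ : -1 < s₁)
    (h₂₁ : s₂ < 1) (h₁₃ : 1 < s₃) (h₁ : s₁ ≤ y) (h₂ : y < s₂) :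
    IntervalIntegrable (precessionKernel s₁ s₂ s₃ κ β) MeasureTheory.volume s₁ y := by
  have hw : IntervalIntegrable (fun s : ℝ => (s - s₁) ^ (-(1 / 2) : ℝ))
      MeasureTheory.volume s₁ y := by
    have := (intervalIntegral.intervalIntegrable_rpow' (a := 0) (b := y - s₁)
      (r := -(1 / 2)) (by norm_num)).comp_sub_right s₁
    simpa using this
  have hcont : ContinuousOn
      (fun s => (κ - β * s) / ((1 - s ^ 2) * Real.sqrt ((s - s₂) * (s - s₃))))
      (Set.uIcc s₁ y) := by
    refine ContinuousOn.div (by fun_prop) (by fun_prop) fun s hs => ?_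
    rw [Set.uIcc_of_le h₁] at hs
    have h3 : 0 < (s - s₂) * (s - s₃) := mul_pos_of_neg_of_neg (by linarith [hs.2])
      (by linarith [hs.2])
    have h4 : 0 < 1 - s ^ 2 := by nlinarith [hs.1, hs.2]
    exact (mul_pos h4 (Real.sqrt_pos.mpr h3)).ne'
  refine (hw.mul_continuousOn hcont).congr fun s hs => ?_
  rw [Set.uIoc_of_le h₁] at hs
  exact (precessionKernel_eq_rpow_mul κ β hs.1.le).symm

/-- The second argument can be less than `-1`, outside the region of the series; this is why the
analytic continuation is needed. -/
theorem lauricellaArgs_lt_one {s₁ s₂ s₃ y : ℝ} (h₀₁ : -1 < s₁) (h₁₂ : s₁ < s₂) (h₂₁ : s₂ < 1)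
    (h₁₃ : 1 < s₃) (h₁ : s₁ ≤ y) (h₂ : y < s₂) (i : Fin 4) : lauricellaArgs s₁ s₂ s₃ y i < 1 := by
  have hx1 : (y - s₁) / (1 - s₁) < 1 := by rw [div_lt_one] <;> linarith
  have hx2 : -((y - s₁) / (1 + s₁)) < 1 := by
    have : 0 ≤ (y - s₁) / (1 + s₁) := div_nonneg (by linarith) (by linarith)
    linarith
  have hx3 : -((y - s₁) / (s₁ - s₃)) < 1 := by
    rw [← div_neg, div_lt_one] <;> linarith
  have hx4 : -((y - s₁) / (s₁ - s₂)) < 1 := by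
    rw [← div_neg, div_lt_one] <;> linarith
  fin_cases i <;> simp only [lauricellaArgs] <;> assumption

/-- A factor with root `σ ≠ s₁` becomes `s - σ = (s₁ - σ)(1 - x t)` with `x = (y - s₁) / (σ - s₁)`,
and `s - s₁` contributes `t ^ (-1/2)`. The numerator is `(κ - β s₁) - β (y - s₁) t`; its extra `t`
moves the Euler parameter from `1/2` to `3/2`. -/
theorem precessionKernel_affine {s₁ s₂ s₃ y t : ℝ} (κ β : ℝ) (h₀₁ : -1 < s₁) (h₁₂ : s₁ < s₂)
    (h₂₁ : s₂ < 1) (h₁₃ : 1 < s₃) (h₁ : s₁ < y) (h₂ : y < s₂) (ht₀ : 0 < t) (ht₁ : t ≤ 1) :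
    precessionKernel s₁ s₂ s₃ κ β (s₁ + (y - s₁) * t) =
      1 / (Real.sqrt (y - s₁) * ((1 - s₁ ^ 2) * Real.sqrt ((s₃ - s₁) * (s₂ - s₁)))) *
      ((κ - β * s₁) * (t ^ (1 / 2 - 1 : ℝ) * ∏ i, (1 - lauricellaArgs s₁ s₂ s₃ y i * t) ^
          (-(![1, 1, 1 / 2, 1 / 2] : Fin 4 → ℝ) i)) -
        β * (y - s₁) * (t ^ (3 / 2 - 1 : ℝ) * ∏ i, (1 - lauricellaArgs s₁ s₂ s₃ y i * t) ^
          (-(![1, 1, 1 / 2, 1 / 2] : Fin 4 → ℝ) i))) := by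
  have hpos : ∀ i, 0 < 1 - lauricellaArgs s₁ s₂ s₃ y i * t := fun i =>
    one_sub_mul_pos (lauricellaArgs_lt_one h₀₁ h₁₂ h₂₁ h₁₃ h₁.le h₂ i) ht₀.le ht₁
  have p0 := hpos 0
  have p1 := hpos 1
  have p2 := hpos 2
  have p3 := hpos 3
  have hδ : 0 < y - s₁ := by linarith
  have hD : 0 < (s₃ - s₁) * (s₂ - s₁) := mul_pos (by linarith) (by linarith)
  have e1 : t ^ (1 / 2 - 1 : ℝ) = (Real.sqrt t)⁻¹ := by
    rw [Real.sqrt_eq_rpow, ← Real.rpow_neg ht₀.le]; norm_num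
  have e2 : t ^ (3 / 2 - 1 : ℝ) = Real.sqrt t := by
    rw [Real.sqrt_eq_rpow]; norm_num
  have e3 : t = Real.sqrt t * Real.sqrt t := (Real.mul_self_sqrt ht₀.le).symm
  have hsq : ∀ z : ℝ, 0 < z → z ^ (-(1 / 2) : ℝ) = (Real.sqrt z)⁻¹ := fun z hz => by
    rw [Real.rpow_neg hz.le, Real.sqrt_eq_rpow]
  have hprod : ∏ i, (1 - lauricellaArgs s₁ s₂ s₃ y i * t) ^
      (-(![1, 1, 1 / 2, 1 / 2] : Fin 4 → ℝ) i) =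
      (1 - lauricellaArgs s₁ s₂ s₃ y 0 * t)⁻¹ * (1 - lauricellaArgs s₁ s₂ s₃ y 1 * t)⁻¹ *
      (Real.sqrt (1 - lauricellaArgs s₁ s₂ s₃ y 2 * t))⁻¹ *
      (Real.sqrt (1 - lauricellaArgs s₁ s₂ s₃ y 3 * t))⁻¹ := by
    rw [Fin.prod_univ_four, ← hsq _ p2, ← hsq _ p3, ← Real.rpow_neg_one, ← Real.rpow_neg_one]
    rfl
  have f0 : 1 - (s₁ + (y - s₁) * t) ^ 2 = (1 - s₁ ^ 2) *
      ((1 - lauricellaArgs s₁ s₂ s₃ y 0 * t) * (1 - lauricellaArgs s₁ s₂ s₃ y 1 * t)) := by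
    have : 1 - s₁ ≠ 0 := by linarith
    have : 1 + s₁ ≠ 0 := by linarith
    simp only [lauricellaArgs, Matrix.cons_val]
    field_simp
    ring
  have f1 : (s₁ + (y - s₁) * t - s₁) * (s₁ + (y - s₁) * t - s₂) * (s₁ + (y - s₁) * t - s₃) =
      (y - s₁) * (t * (((s₃ - s₁) * (s₂ - s₁)) * ((1 - lauricellaArgs s₁ s₂ s₃ y 2 * t) *
        (1 - lauricellaArgs s₁ s₂ s₃ y 3 * t)))) := by
    have : s₁ - s₃ ≠ 0 := by linarith
    have : s₁ - s₂ ≠ 0 := by linarith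
    simp only [lauricellaArgs, Matrix.cons_val]
    field_simp
    ring
  rw [precessionKernel, f0, f1, Real.sqrt_mul hδ.le, Real.sqrt_mul ht₀.le, Real.sqrt_mul hD.le,
    Real.sqrt_mul p2.le, hprod, e1, e2]
  have q1 := (Real.sqrt_pos.mpr hδ).ne'
  have q2 := (Real.sqrt_pos.mpr hD).ne'
  have q3 := (Real.sqrt_pos.mpr p2).ne'
  have q4 := (Real.sqrt_pos.mpr p3).ne'
  have q5 := (Real.sqrt_pos.mpr ht₀).ne'
  have q6 : 1 - s₁ ^ 2 ≠ 0 := by nlinarith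
  have q7 := p0.ne'
  have q8 := p1.ne'
  generalize 1 - lauricellaArgs s₁ s₂ s₃ y 0 * t = u0 at *
  generalize 1 - lauricellaArgs s₁ s₂ s₃ y 1 * t = u1 at *
  generalize Real.sqrt (1 - lauricellaArgs s₁ s₂ s₃ y 2 * t) = u2 at *
  generalize Real.sqrt (1 - lauricellaArgs s₁ s₂ s₃ y 3 * t) = u3 at *
  generalize Real.sqrt (y - s₁) = d at *
  generalize Real.sqrt ((s₃ - s₁) * (s₂ - s₁)) = D at *
  field_simp
  rw [Real.sq_sqrt ht₀.le]
  ring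

/-- The quadrature in closed form. -/
theorem integral_precessionKernel {s₁ s₂ s₃ y : ℝ} (κ β : ℝ) (h₀₁ : -1 < s₁) (h₁₂ : s₁ < s₂)
    (h₂₁ : s₂ < 1) (h₁₃ : 1 < s₃) (h₁ : s₁ ≤ y) (h₂ : y < s₂) :
    ∫ s in s₁..y, precessionKernel s₁ s₂ s₃ κ β s = precessionForm s₁ s₂ s₃ κ β y := by
  rcases h₁.eq_or_lt with rfl | h₁'
  · simp [precessionForm]
  have hX := lauricellaArgs_lt_one h₀₁ h₁₂ h₂₁ h₁₃ h₁ h₂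
  have hΞ := lauricellaFD_eq_eulerIntegral (a := 1 / 2) (by norm_num) ![1, 1, 1 / 2, 1 / 2] hX
  rw [show (1 / 2 + 1 : ℝ) = 3 / 2 by norm_num, ← lauricellaXi] at hΞ
  have hΛ := lauricellaFD_eq_eulerIntegral (a := 3 / 2) (by norm_num) ![1, 1, 1 / 2, 1 / 2] hX
  rw [show (3 / 2 + 1 : ℝ) = 5 / 2 by norm_num, ← lauricellaLambda] at hΛ
  have hint : ∀ a : ℝ, 0 < a → IntervalIntegrable (fun t : ℝ => t ^ (a - 1) *
      ∏ i, (1 - lauricellaArgs s₁ s₂ s₃ y i * t) ^ (-(![1, 1, 1 / 2, 1 / 2] : Fin 4 → ℝ) i))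
      MeasureTheory.volume 0 1 := fun a ha => by
    refine (intervalIntegral.intervalIntegrable_rpow' (by linarith)).mul_continuousOn ?_
    refine continuousOn_finsetProd _ fun i _ => ContinuousOn.rpow_const (by fun_prop)
      fun t ht => Or.inl ?_
    rw [Set.uIcc_of_le zero_le_one] at ht
    exact (one_sub_mul_pos (hX i) ht.1 ht.2).ne'
  have hsub := intervalIntegral.mul_integral_comp_add_mul (a := 0) (b := 1)
    (f := precessionKernel s₁ s₂ s₃ κ β) (y - s₁) s₁
  rw [mul_zero, add_zero, mul_one, add_sub_cancel] at hsub
  have haff := intervalIntegral.integral_congr_ae (μ := MeasureTheory.volume) (a := 0) (b := 1)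
    (Filter.Eventually.of_forall fun t (ht : t ∈ Set.uIoc (0 : ℝ) 1) =>
      precessionKernel_affine κ β h₀₁ h₁₂ h₂₁ h₁₃ h₁' h₂
        (Set.uIoc_of_le (zero_le_one' ℝ) ▸ ht).1 (Set.uIoc_of_le (zero_le_one' ℝ) ▸ ht).2)
  rw [← hsub, haff,
    intervalIntegral.integral_const_mul, intervalIntegral.integral_sub
      ((hint _ (by norm_num)).const_mul _) ((hint _ (by norm_num)).const_mul _),
    intervalIntegral.integral_const_mul, intervalIntegral.integral_const_mul, precessionForm,
    hΞ, hΛ, lauricellaEulerIntegral, lauricellaEulerIntegral]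
  have hδ : 0 < y - s₁ := by linarith
  have q0 := Real.sq_sqrt hδ.le
  have q1 := (Real.sqrt_pos.mpr hδ).ne'
  have q2 : Real.sqrt ((s₃ - s₁) * (s₂ - s₁)) ≠ 0 :=
    (Real.sqrt_pos.mpr (mul_pos (by linarith) (by linarith))).ne'
  have q3 : 1 - s₁ ^ 2 ≠ 0 := by nlinarith
  generalize Real.sqrt (y - s₁) = d at *
  generalize Real.sqrt ((s₃ - s₁) * (s₂ - s₁)) = D at *
  -- `Ξ = I₁ / 2` and `Λ = 3 I₂ / 2` account for the constants `2` and `β / 3`; the Jacobian `y - s₁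
  -- = d ^ 2` against `1 / d` leaves the square root in the numerator.
  generalize (∫ t in (0 : ℝ)..1, t ^ (1 / 2 - 1 : ℝ) * _) = I₁
  generalize (∫ t in (0 : ℝ)..1, t ^ (3 / 2 - 1 : ℝ) * _) = I₂
  rw [← q0]
  field_simp

theorem hasDerivAt_precessionForm {s₁ s₂ s₃ s : ℝ} (κ β : ℝ) (h₀₁ : -1 < s₁) (h₁₂ : s₁ < s₂)
    (h₂₁ : s₂ < 1) (h₁₃ : 1 < s₃) (h₁ : s₁ < s) (h₂ : s < s₂) :
    HasDerivAt (precessionForm s₁ s₂ s₃ κ β) (precessionKernel s₁ s₂ s₃ κ β s) s := by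
  have hcont : ∀ z ∈ Set.Ioo s₁ s₂, ContinuousAt (precessionKernel s₁ s₂ s₃ κ β) z := by
    intro z hz
    have h3 : 0 < (z - s₁) * (z - s₂) * (z - s₃) :=
      mul_pos_of_neg_of_neg (mul_neg_of_pos_of_neg (by linarith [hz.1]) (by linarith [hz.2]))
        (by linarith [hz.2])
    have h4 : 0 < 1 - z ^ 2 := by nlinarith [hz.1, hz.2]
    exact ContinuousAt.div (by fun_prop) (by fun_prop) (mul_pos h4 (Real.sqrt_pos.mpr h3)).ne'
  have hmeas : StronglyMeasurableAtFilter (precessionKernel s₁ s₂ s₃ κ β) (nhds s) :=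
    ContinuousAt.stronglyMeasurableAtFilter isOpen_Ioo hcont s ⟨h₁, h₂⟩
  have h := intervalIntegral.integral_hasDerivAt_right
    (intervalIntegrable_precessionKernel κ β h₀₁ h₂₁ h₁₃ h₁.le h₂) hmeas (hcont s ⟨h₁, h₂⟩)
  refine h.congr_of_eventuallyEq ?_
  filter_upwards [isOpen_Ioo.mem_nhds (⟨h₁, h₂⟩ : s ∈ Set.Ioo s₁ s₂)] with y hy
  exact (integral_precessionKernel κ β h₀₁ h₁₂ h₂₁ h₁₃ hy.1.le hy.2).symm

/-- As a primitive of an integrable function, the form is continuous up to `s₁`, where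
`hasDerivAt_precessionForm` gives nothing. -/
theorem continuousOn_precessionForm {s₁ s₂ s₃ y : ℝ} (κ β : ℝ) (h₀₁ : -1 < s₁) (h₁₂ : s₁ < s₂)
    (h₂₁ : s₂ < 1) (h₁₃ : 1 < s₃) (h₁ : s₁ ≤ y) (h₂ : y < s₂) :
    ContinuousOn (precessionForm s₁ s₂ s₃ κ β) (Set.Icc s₁ y) := by
  have h := intervalIntegral.continuousOn_primitive_interval'
    (intervalIntegrable_precessionKernel κ β h₀₁ h₂₁ h₁₃ h₁ h₂) Set.left_mem_uIcc
  rw [Set.uIcc_of_le h₁] at h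
  exact h.congr fun z hz =>
    (integral_precessionKernel κ β h₀₁ h₁₂ h₂₁ h₁₃ hz.1 (hz.2.trans_lt h₂)).symm

/-! ### First integrals of the top and the resolvent cubic -/

/-- Viète's relations for the cubic `(α - β s)(1 - s²) - (κ - η s)²`. -/
theorem vieta_of_cubic_roots {α β κ η s₁ s₂ s₃ : ℝ} (h₁₂ : s₁ ≠ s₂) (h₁₃ : s₁ ≠ s₃)
    (h₂₃ : s₂ ≠ s₃) (h₁ : (α - β * s₁) * (1 - s₁ ^ 2) - (κ - η * s₁) ^ 2 = 0)
    (h₂ : (α - β * s₂) * (1 - s₂ ^ 2) - (κ - η * s₂) ^ 2 = 0)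
    (h₃ : (α - β * s₃) * (1 - s₃ ^ 2) - (κ - η * s₃) ^ 2 = 0) :
    α + η ^ 2 = β * (s₁ + s₂ + s₃) ∧
      2 * κ * η - β = β * (s₁ * s₂ + s₁ * s₃ + s₂ * s₃) ∧
      α - κ ^ 2 = -(β * (s₁ * s₂ * s₃)) := by
  -- Divided differences of the cubic; a second one, of `d₁₂` and `d₁₃`, isolates the sum of the
  -- roots.
  have d₁₂ : β * (s₁ ^ 2 + s₁ * s₂ + s₂ ^ 2) - (α + η ^ 2) * (s₁ + s₂) + (2 * κ * η - β) = 0 :=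
    mul_left_cancel₀ (sub_ne_zero.mpr h₁₂) (by linear_combination h₁ - h₂)
  have d₁₃ : β * (s₁ ^ 2 + s₁ * s₃ + s₃ ^ 2) - (α + η ^ 2) * (s₁ + s₃) + (2 * κ * η - β) = 0 :=
    mul_left_cancel₀ (sub_ne_zero.mpr h₁₃) (by linear_combination h₁ - h₃)
  have e₁ : α + η ^ 2 = β * (s₁ + s₂ + s₃) :=
    mul_left_cancel₀ (sub_ne_zero.mpr h₂₃) (by linear_combination d₁₃ - d₁₂)
  have e₂ : 2 * κ * η - β = β * (s₁ * s₂ + s₁ * s₃ + s₂ * s₃) := by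
    linear_combination d₁₂ + (s₁ + s₂) * e₁
  exact ⟨e₁, e₂, by linear_combination h₁ - s₁ * e₂ + s₁ ^ 2 * e₁⟩

theorem Convex.eq_of_hasDerivWithinAt_zero {f : ℝ → ℝ} {J : Set ℝ} (hJ : Convex ℝ J)
    (hf : ∀ t ∈ J, HasDerivWithinAt f 0 J t) {x y : ℝ} (hx : x ∈ J) (hy : y ∈ J) : f x = f y := by
  have h := hJ.norm_image_sub_le_of_norm_hasDerivWithin_le (C := 0) hf (by simp) hy hx
  rw [zero_mul, norm_le_zero_iff, sub_eq_zero] at h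
  exact h

namespace HeavySymmetricTop

variable {T : HeavySymmetricTop} {J : Set ℝ} {e : EulerAngles}

theorem rhoHat_pos (T : HeavySymmetricTop) : 0 < T.rhoHat := by
  have := T.A_pos
  have := T.M_pos
  have := T.g_pos
  have := T.zG_pos
  exact Real.sqrt_pos.mpr (by positivity)

theorem rhoHat_sq (T : HeavySymmetricTop) : T.rhoHat ^ 2 = 2 * (T.M * T.g * T.zG / T.A) := by
  have := T.A_pos
  have := T.M_pos
  have := T.g_pos
  have := T.zG_pos
  exact Real.sq_sqrt (by positivity)

theorem kHat_mul_rhoHat (T : HeavySymmetricTop) (K₀ : ℝ) : T.rhoHat * T.kHat K₀ = K₀ / T.A := by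
  have := T.A_pos.ne'
  have := T.rhoHat_pos.ne'
  rw [kHat]
  field_simp

theorem cConst_mul_lam_mul_rhoHat (T : HeavySymmetricTop) (r₀ : ℝ) :
    T.rhoHat * (T.cConst * T.lam r₀) = T.C / T.A * r₀ := by
  have := T.A_pos.ne'
  have := T.rhoHat_pos.ne'
  rw [lam, cConst]
  field_simp

/-- In this form, with the constants of the motion and `s = γ₃`, the first bracket is `p² + q²` and
the squared one is `p γ₁ + q γ₂`. -/
theorem resolvent_eq (T : HeavySymmetricTop) (E₀ K₀ r₀ s : ℝ) :
    T.resolvent E₀ K₀ r₀ s =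
      ((2 * E₀ - T.C * r₀ ^ 2) / T.A - T.rhoHat ^ 2 * s) * (1 - s ^ 2) -
        (K₀ / T.A - T.C / T.A * r₀ * s) ^ 2 := by
  have h1 : T.rhoHat ^ 2 * (T.hConst E₀ - T.cConst * T.lam r₀ ^ 2) =
      (2 * E₀ - T.C * r₀ ^ 2) / T.A := by
    have hA := T.A_pos.ne'
    have hM := T.M_pos.ne'
    have hg := T.g_pos.ne'
    have hz := T.zG_pos.ne'
    have hρ := T.rhoHat_pos.ne'
    have h2 : T.rhoHat ^ 2 * (T.cConst * T.lam r₀ ^ 2) = T.C * r₀ ^ 2 / T.A := by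
      rw [lam, cConst]
      field_simp
    rw [mul_sub, h2, rhoHat_sq, hConst]
    field_simp
  rw [resolvent, ← h1, ← kHat_mul_rhoHat, ← cConst_mul_lam_mul_rhoHat]
  ring

namespace IsMotion

/-- With the next two lemmas, these are Poisson's equations `γ' = γ × ω`: the vertical is fixed in
space. -/
theorem hasDeriv_γ₁ (he : T.IsMotion J e) {t : ℝ} (ht : t ∈ J) :
    HasDerivWithinAt e.γ₁ (e.r t * e.γ₂ t - e.q t * e.γ₃ t) J t := by
  refine ((he.hasDeriv_θ t ht).sin.mul (he.hasDeriv_φ t ht).sin).congr_deriv ?_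
  simp only [EulerAngles.r, EulerAngles.q, EulerAngles.γ₂, EulerAngles.γ₃]
  ring

theorem hasDeriv_γ₂ (he : T.IsMotion J e) {t : ℝ} (ht : t ∈ J) :
    HasDerivWithinAt e.γ₂ (e.p t * e.γ₃ t - e.r t * e.γ₁ t) J t := by
  refine ((he.hasDeriv_θ t ht).sin.mul (he.hasDeriv_φ t ht).cos).congr_deriv ?_
  simp only [EulerAngles.r, EulerAngles.p, EulerAngles.γ₁, EulerAngles.γ₃]
  ring

theorem hasDeriv_γ₃ (he : T.IsMotion J e) {t : ℝ} (ht : t ∈ J) :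
    HasDerivWithinAt e.γ₃ (e.q t * e.γ₁ t - e.p t * e.γ₂ t) J t := by
  refine (he.hasDeriv_θ t ht).cos.congr_deriv ?_
  simp only [EulerAngles.p, EulerAngles.q, EulerAngles.γ₁, EulerAngles.γ₂]
  linear_combination (e.θ' t * Real.sin (e.θ t)) * Real.sin_sq_add_cos_sq (e.φ t)

theorem r_eq (he : T.IsMotion J e) (hJ : Convex ℝ J) {t τ : ℝ} (ht : t ∈ J) (hτ : τ ∈ J) :
    e.r t = e.r τ :=
  hJ.eq_of_hasDerivWithinAt_zero he.euler_r ht hτ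

theorem energy_eq (he : T.IsMotion J e) (hJ : Convex ℝ J) {t τ : ℝ} (ht : t ∈ J) (hτ : τ ∈ J) :
    T.energy e t = T.energy e τ := by
  have hA := T.A_pos.ne'
  refine hJ.eq_of_hasDerivWithinAt_zero (fun x hx => ?_) ht hτ
  have h := ((((((he.euler_p x hx).pow 2).const_mul T.A).add
    (((he.euler_q x hx).pow 2).const_mul T.A)).add
    (((he.euler_r x hx).pow 2).const_mul T.C)).div_const 2).add
    ((he.hasDeriv_γ₃ hx).const_mul (T.M * T.g * T.zG))
  refine h.congr_deriv ?_
  field_simp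
  ring

theorem verticalMomentum_eq (he : T.IsMotion J e) (hJ : Convex ℝ J) {t τ : ℝ} (ht : t ∈ J)
    (hτ : τ ∈ J) : T.verticalMomentum e t = T.verticalMomentum e τ := by
  have hA := T.A_pos.ne'
  refine hJ.eq_of_hasDerivWithinAt_zero (fun x hx => ?_) ht hτ
  have h := ((((he.euler_p x hx).const_mul T.A).mul (he.hasDeriv_γ₁ hx)).add
    (((he.euler_q x hx).const_mul T.A).mul (he.hasDeriv_γ₂ hx))).add
    (((he.euler_r x hx).const_mul T.C).mul (he.hasDeriv_γ₃ hx))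
  refine h.congr_deriv ?_
  field_simp
  ring

end IsMotion

theorem p_sq_add_q_sq (T : HeavySymmetricTop) (e : EulerAngles) (t : ℝ) :
    e.p t ^ 2 + e.q t ^ 2 =
      (2 * T.energy e t - T.C * e.r t ^ 2) / T.A - T.rhoHat ^ 2 * e.γ₃ t := by
  have := T.A_pos.ne'
  rw [rhoHat_sq, energy]
  field_simp
  ring

theorem p_mul_add_q_mul (T : HeavySymmetricTop) (e : EulerAngles) (t : ℝ) :
    e.p t * e.γ₁ t + e.q t * e.γ₂ t =
      T.verticalMomentum e t / T.A - T.C / T.A * e.r t * e.γ₃ t := by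
  have := T.A_pos.ne'
  rw [verticalMomentum]
  field_simp
  ring

theorem γ_sq (e : EulerAngles) (t : ℝ) : e.γ₁ t ^ 2 + e.γ₂ t ^ 2 = 1 - e.γ₃ t ^ 2 := by
  simp only [EulerAngles.γ₁, EulerAngles.γ₂, EulerAngles.γ₃]
  linear_combination Real.sin_sq_add_cos_sq (e.θ t) +
    Real.sin (e.θ t) ^ 2 * Real.sin_sq_add_cos_sq (e.φ t)

/-- The `θ'` terms cancel in `p γ₁ + q γ₂`. No division by `sin θ` occurs. -/
theorem ψ'_mul (e : EulerAngles) (t : ℝ) :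
    e.ψ' t * (1 - e.γ₃ t ^ 2) = e.p t * e.γ₁ t + e.q t * e.γ₂ t := by
  rw [← γ_sq]
  simp only [EulerAngles.γ₁, EulerAngles.γ₂, EulerAngles.p, EulerAngles.q]
  ring

/-- The square of the rate of change of `cos θ` is the resolvent cubic. -/
theorem sq_eq_resolvent (T : HeavySymmetricTop) (e : EulerAngles) (t : ℝ) :
    (e.q t * e.γ₁ t - e.p t * e.γ₂ t) ^ 2 =
      T.resolvent (T.energy e t) (T.verticalMomentum e t) (e.r t) (e.γ₃ t) := by
  -- What remains is Lagrange's identity for the plane vectors `(p, q)` and `(γ₁, γ₂)`.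
  rw [resolvent_eq, ← p_sq_add_q_sq, ← p_mul_add_q_mul, ← γ_sq]
  ring

/-- The second derivative of `cos θ` is half the derivative of the resolvent cubic. -/
theorem IsMotion.hasDeriv_γ₃_rate (he : T.IsMotion J e) {t : ℝ} (ht : t ∈ J) :
    HasDerivWithinAt (fun x => e.q x * e.γ₁ x - e.p x * e.γ₂ x)
      (-(T.rhoHat ^ 2 / 2 * (1 - e.γ₃ t ^ 2)) - e.γ₃ t * (e.p t ^ 2 + e.q t ^ 2) +
        T.C / T.A * e.r t * (e.p t * e.γ₁ t + e.q t * e.γ₂ t)) J t := by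
  have hA := T.A_pos.ne'
  refine (((he.euler_q t ht).mul (he.hasDeriv_γ₁ ht)).sub
    ((he.euler_p t ht).mul (he.hasDeriv_γ₂ ht))).congr_deriv ?_
  rw [← γ_sq, rhoHat_sq]
  field_simp
  ring

end HeavySymmetricTop

/-! ### The reduced motion and the precession angle -/

/-- A motion of the top whose resolvent cubic has the roots `s₁ < s₂ < s₃`, reduced to what governs
the precession: `u = cos θ`, its rate of change `v`, and the precession angle `ψ`. -/
structure IsReducedMotion (ρ k l s₁ s₂ s₃ : ℝ) (J : Set ℝ) (u v ψ ψ' : ℝ → ℝ) : Prop where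
  hasDeriv_u : ∀ t ∈ J, HasDerivWithinAt u (v t) J t
  hasDeriv_v : ∀ t ∈ J, HasDerivWithinAt v (ρ ^ 2 / 2 * ((u t - s₁) * (u t - s₂) +
    (u t - s₁) * (u t - s₃) + (u t - s₂) * (u t - s₃))) J t
  hasDeriv_ψ : ∀ t ∈ J, HasDerivWithinAt ψ (ψ' t) J t
  v_sq : ∀ t ∈ J, v t ^ 2 = ρ ^ 2 * ((u t - s₁) * (u t - s₂) * (u t - s₃))
  ψ'_mul : ∀ t ∈ J, ψ' t * (1 - u t ^ 2) = ρ * (k - l * u t)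
  u_le_one : ∀ t ∈ J, u t ≤ 1

theorem HeavySymmetricTop.IsMotion.isReducedMotion {T : HeavySymmetricTop} {J : Set ℝ}
    {e : EulerAngles} (he : T.IsMotion J e) (hJ : J.OrdConnected) {τ E₀ K₀ r₀ : ℝ} (hτ : τ ∈ J)
    (hE : T.energy e τ = E₀) (hK : T.verticalMomentum e τ = K₀) (hr : e.r τ = r₀)
    {s₁ s₂ s₃ : ℝ} (hs₁ : T.resolvent E₀ K₀ r₀ s₁ = 0) (hs₂ : T.resolvent E₀ K₀ r₀ s₂ = 0)
    (hs₃ : T.resolvent E₀ K₀ r₀ s₃ = 0) (h₁₂ : s₁ ≠ s₂) (h₁₃ : s₁ ≠ s₃) (h₂₃ : s₂ ≠ s₃) :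
    IsReducedMotion T.rhoHat (T.kHat K₀) (T.cConst * T.lam r₀) s₁ s₂ s₃ J
      (fun t => Real.cos (e.θ t)) (fun t => e.q t * e.γ₁ t - e.p t * e.γ₂ t) e.ψ e.ψ' := by
  have hE' : ∀ t ∈ J, T.energy e t = E₀ := fun t ht => (he.energy_eq hJ.convex ht hτ).trans hE
  have hK' : ∀ t ∈ J, T.verticalMomentum e t = K₀ := fun t ht =>
    (he.verticalMomentum_eq hJ.convex ht hτ).trans hK
  have hr' : ∀ t ∈ J, e.r t = r₀ := fun t ht => (he.r_eq hJ.convex ht hτ).trans hr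
  rw [T.resolvent_eq] at hs₁ hs₂ hs₃
  obtain ⟨w₁, w₂, w₃⟩ := vieta_of_cubic_roots h₁₂ h₁₃ h₂₃ hs₁ hs₂ hs₃
  refine ⟨fun t ht => he.hasDeriv_γ₃ ht, fun t ht => ?_, he.hasDeriv_ψ, fun t ht => ?_,
    fun t ht => ?_, fun t _ => Real.cos_le_one _⟩
  · refine (he.hasDeriv_γ₃_rate ht).congr_deriv ?_
    rw [T.p_sq_add_q_sq, T.p_mul_add_q_mul, hE' t ht, hK' t ht, hr' t ht]
    change _ = T.rhoHat ^ 2 / 2 * ((e.γ₃ t - s₁) * (e.γ₃ t - s₂) +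
      (e.γ₃ t - s₁) * (e.γ₃ t - s₃) + (e.γ₃ t - s₂) * (e.γ₃ t - s₃))
    linear_combination -(e.γ₃ t) * w₁ + w₂ / 2
  · rw [T.sq_eq_resolvent, hE' t ht, hK' t ht, hr' t ht, T.resolvent_eq]
    change _ = T.rhoHat ^ 2 * ((e.γ₃ t - s₁) * (e.γ₃ t - s₂) * (e.γ₃ t - s₃))
    linear_combination -(e.γ₃ t) ^ 2 * w₁ + e.γ₃ t * w₂ + w₃
  · change e.ψ' t * (1 - e.γ₃ t ^ 2) = T.rhoHat * (_ - _ * e.γ₃ t)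
    rw [HeavySymmetricTop.ψ'_mul, T.p_mul_add_q_mul, hK' t ht, hr' t ht, mul_sub, ← mul_assoc,
      T.kHat_mul_rhoHat, T.cConst_mul_lam_mul_rhoHat]

namespace IsReducedMotion

variable {ρ k l s₁ s₂ s₃ : ℝ} {J : Set ℝ} {u v ψ ψ' : ℝ → ℝ}

/-- The cubic is nonnegative along the motion, and `u ≤ 1 < s₃` fixes the sign of its last factor.
-/
theorem mem_Icc (h : IsReducedMotion ρ k l s₁ s₂ s₃ J u v ψ ψ') (hρ : 0 < ρ) (h₁₂ : s₁ < s₂)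
    (h₁₃ : 1 < s₃) {t : ℝ} (ht : t ∈ J) : u t ∈ Set.Icc s₁ s₂ := by
  have h1 : 0 ≤ (u t - s₁) * (u t - s₂) * (u t - s₃) :=
    nonneg_of_mul_nonneg_right (h.v_sq t ht ▸ sq_nonneg (v t)) (by positivity)
  have h2 : (u t - s₁) * (u t - s₂) ≤ 0 := by
    by_contra! hc
    have := mul_neg_of_pos_of_neg hc (sub_neg.mpr ((h.u_le_one t ht).trans_lt h₁₃))
    linarith
  constructor <;> nlinarith

/-- The simple root `s₁` is not an equilibrium. -/
theorem not_forall_eq (h : IsReducedMotion ρ k l s₁ s₂ s₃ J u v ψ ψ') (hρ : 0 < ρ) (h₁₂ : s₁ < s₂)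
    (h₁₃ : s₁ < s₃) {a b : ℝ} (hab : a < b) (hJ : Set.Ioo a b ⊆ J) :
    ¬ ∀ x ∈ Set.Ioo a b, u x = s₁ := by
  intro hu
  have hv : ∀ x ∈ Set.Ioo a b, v x = 0 := fun x hx => by
    have := h.v_sq x (hJ hx)
    rw [hu x hx, sub_self, zero_mul, zero_mul, mul_zero] at this
    exact pow_eq_zero_iff two_ne_zero |>.mp this
  obtain ⟨x, hx⟩ := Set.nonempty_Ioo.mpr hab
  have hn : Set.Ioo a b ∈ nhds x := isOpen_Ioo.mem_nhds hx
  -- Constancy forces `v' = 0`, but at `s₁` the equation of motion gives `v' = ρ² / 2 * (s₁ - s₂)(s₁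
  -- - s₃)`, which is positive.
  have h1 := (h.hasDeriv_v x (hJ hx)).hasDerivAt (Filter.mem_of_superset hn hJ)
  have h2 : HasDerivAt v 0 x := (hasDerivAt_const x (0 : ℝ)).congr_of_eventuallyEq
    (Filter.mem_of_superset hn fun y hy => hv y hy)
  have h3 := h1.unique h2
  rw [hu x hx] at h3
  have : 0 < (s₁ - s₂) * (s₁ - s₃) := mul_pos_of_neg_of_neg (by linarith) (by linarith)
  have h4 : (s₁ - s₂) * (s₁ - s₃) = 0 := by
    have : ρ ^ 2 / 2 ≠ 0 := by positivity
    have := (mul_eq_zero.mp h3).resolve_left this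
    linarith
  linarith

/-- The sign `ε = ±1` selects the branch of the square root: `ε v = ρ √(…)`. Hence `ψ - ε *
precessionForm (u)` has zero derivative inside the interval, and the mean value theorem equates its
end values. -/
theorem ψ_sub_eq (h : IsReducedMotion ρ k l s₁ s₂ s₃ J u v ψ ψ') (hρ : 0 < ρ) (h₀₁ : -1 < s₁)
    (h₁₂ : s₁ < s₂) (h₂₁ : s₂ < 1) (h₁₃ : 1 < s₃) {a b ε y : ℝ} (hab : a ≤ b)
    (hJ : Set.Icc a b ⊆ J) (hε : ε ^ 2 = 1) (hy : y < s₂) (huy : ∀ x ∈ Set.Icc a b, u x ≤ y)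
    (hu : ∀ x ∈ Set.Ioo a b, s₁ < u x) (hv : ∀ x ∈ Set.Ioo a b, 0 ≤ ε * v x) :
    ψ b - ψ a = ε * (precessionForm s₁ s₂ s₃ k l (u b) - precessionForm s₁ s₂ s₃ k l (u a)) := by
  rcases hab.eq_or_lt with rfl | hab
  · simp
  have hmem : ∀ x ∈ Set.Icc a b, u x ∈ Set.Icc s₁ y := fun x hx =>
    ⟨(h.mem_Icc hρ h₁₂ h₁₃ (hJ hx)).1, huy x hx⟩
  have hsy : s₁ ≤ y := (hmem a ⟨le_rfl, hab.le⟩).1.trans (huy a ⟨le_rfl, hab.le⟩)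
  have hcu : ContinuousOn u (Set.Icc a b) := fun x hx =>
    (h.hasDeriv_u x (hJ hx)).continuousWithinAt.mono hJ
  have hcψ : ContinuousOn ψ (Set.Icc a b) := fun x hx =>
    (h.hasDeriv_ψ x (hJ hx)).continuousWithinAt.mono hJ
  obtain ⟨x, hx, hx'⟩ := exists_hasDerivAt_eq_slope
    (fun x => ψ x - ε * precessionForm s₁ s₂ s₃ k l (u x))
    (fun x => ψ' x - ε * (precessionKernel s₁ s₂ s₃ k l (u x) * v x)) hab
    (hcψ.sub (continuousOn_const.mul
      ((continuousOn_precessionForm k l h₀₁ h₁₂ h₂₁ h₁₃ hsy hy).comp hcu hmem)))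
    (fun x hx => by
      have hn : J ∈ nhds x := Filter.mem_of_superset (Icc_mem_nhds hx.1 hx.2) hJ
      have hxJ := hJ (Set.Ioo_subset_Icc_self hx)
      exact ((h.hasDeriv_ψ x hxJ).hasDerivAt hn).sub
        (((hasDerivAt_precessionForm k l h₀₁ h₁₂ h₂₁ h₁₃ (hu x hx)
          ((huy x (Set.Ioo_subset_Icc_self hx)).trans_lt hy)).comp x
          ((h.hasDeriv_u x hxJ).hasDerivAt hn)).const_mul ε))
  have hxI := Set.Ioo_subset_Icc_self hx
  have hP : 0 < (u x - s₁) * (u x - s₂) * (u x - s₃) :=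
    mul_pos_of_neg_of_neg (mul_neg_of_pos_of_neg (by linarith [hu x hx]) (by linarith [huy x hxI]))
      (by linarith [huy x hxI])
  have hvx : ε * v x = ρ * Real.sqrt ((u x - s₁) * (u x - s₂) * (u x - s₃)) := by
    rw [← Real.sqrt_sq (hv x hx), mul_pow, hε, one_mul, h.v_sq x (hJ hxI),
      Real.sqrt_mul (sq_nonneg ρ), Real.sqrt_sq hρ.le]
  have hzero : ψ' x - ε * (precessionKernel s₁ s₂ s₃ k l (u x) * v x) = 0 := by
    have h1 : 1 - u x ^ 2 ≠ 0 := by nlinarith [hu x hx, huy x hxI]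
    have h2 := (Real.sqrt_pos.mpr hP).ne'
    rw [mul_left_comm, hvx, precessionKernel, eq_div_of_mul_eq h1 (h.ψ'_mul x (hJ hxI))]
    field_simp
    ring
  rw [hzero, eq_comm, div_eq_zero_iff, or_iff_left (sub_ne_zero.mpr hab.ne')] at hx'
  linear_combination hx'

theorem ψ_sub_eq_of_monotoneOn (h : IsReducedMotion ρ k l s₁ s₂ s₃ J u v ψ ψ') (hρ : 0 < ρ)
    (h₀₁ : -1 < s₁) (h₁₂ : s₁ < s₂) (h₂₁ : s₂ < 1) (h₁₃ : 1 < s₃) {a b : ℝ} (hab : a ≤ b)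
    (hJ : Set.Icc a b ⊆ J) (hu : MonotoneOn u (Set.Icc a b)) (hb : u b < s₂) :
    ψ b - ψ a = precessionForm s₁ s₂ s₃ k l (u b) - precessionForm s₁ s₂ s₃ k l (u a) := by
  have hge : ∀ x ∈ Set.Icc a b, s₁ ≤ u x := fun x hx => (h.mem_Icc hρ h₁₂ h₁₃ (hJ hx)).1
  rw [h.ψ_sub_eq hρ h₀₁ h₁₂ h₂₁ h₁₃ (ε := 1) hab hJ (one_pow 2) hb
    (fun x hx => hu hx ⟨hab, le_rfl⟩ hx.2) (fun x hx => ?_) (fun x hx => ?_), one_mul]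
  -- If `u x = s₁`, the minimum, monotonicity forces `u = s₁` on all of `(a, x)`.
  · refine (hge x (Set.Ioo_subset_Icc_self hx)).lt_of_ne fun hne => ?_
    refine h.not_forall_eq hρ h₁₂ (by linarith) hx.1
      (fun z hz => hJ ⟨hz.1.le, hz.2.le.trans hx.2.le⟩) fun z hz => ?_
    have hz' : z ∈ Set.Icc a b := ⟨hz.1.le, hz.2.le.trans hx.2.le⟩
    exact le_antisymm (hne ▸ hu hz' (Set.Ioo_subset_Icc_self hx) hz.2.le) (hge z hz')
  · have hn : Set.Icc a b ∈ nhds x := Icc_mem_nhds hx.1 hx.2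
    have hd := (h.hasDeriv_u x (hJ (mem_of_mem_nhds hn))).hasDerivAt (Filter.mem_of_superset hn hJ)
    rw [one_mul, ← hd.deriv, ← derivWithin_of_mem_nhds hn]
    exact hu.derivWithin_nonneg

theorem ψ_sub_eq_of_antitoneOn (h : IsReducedMotion ρ k l s₁ s₂ s₃ J u v ψ ψ') (hρ : 0 < ρ)
    (h₀₁ : -1 < s₁) (h₁₂ : s₁ < s₂) (h₂₁ : s₂ < 1) (h₁₃ : 1 < s₃) {a b : ℝ} (hab : a ≤ b)
    (hJ : Set.Icc a b ⊆ J) (hu : AntitoneOn u (Set.Icc a b)) (ha : u a < s₂) :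
    ψ b - ψ a =
      -(precessionForm s₁ s₂ s₃ k l (u b) - precessionForm s₁ s₂ s₃ k l (u a)) := by
  have hge : ∀ x ∈ Set.Icc a b, s₁ ≤ u x := fun x hx => (h.mem_Icc hρ h₁₂ h₁₃ (hJ hx)).1
  rw [h.ψ_sub_eq hρ h₀₁ h₁₂ h₂₁ h₁₃ (ε := -1) hab hJ (by norm_num) ha
    (fun x hx => hu ⟨le_rfl, hab⟩ hx hx.1) (fun x hx => ?_) (fun x hx => ?_), neg_one_mul]
  -- Here the stretch with `u = s₁` would be `(x, b)`.
  · refine (hge x (Set.Ioo_subset_Icc_self hx)).lt_of_ne fun hne => ?_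
    refine h.not_forall_eq hρ h₁₂ (by linarith) hx.2
      (fun z hz => hJ ⟨hx.1.le.trans hz.1.le, hz.2.le⟩) fun z hz => ?_
    have hz' : z ∈ Set.Icc a b := ⟨hx.1.le.trans hz.1.le, hz.2.le⟩
    exact le_antisymm (hne ▸ hu (Set.Ioo_subset_Icc_self hx) hz' hz.1.le) (hge z hz')
  · have hn : Set.Icc a b ∈ nhds x := Icc_mem_nhds hx.1 hx.2
    have hd := (h.hasDeriv_u x (hJ (mem_of_mem_nhds hn))).hasDerivAt (Filter.mem_of_superset hn hJ)
    rw [neg_one_mul, neg_nonneg, ← hd.deriv, ← derivWithin_of_mem_nhds hn]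
    exact hu.derivWithin_nonpos

end IsReducedMotion

/-! ### The precession formulas -/

theorem mainTheorem1 (T : HeavySymmetricTop) (J : Set ℝ) (hJ : J.OrdConnected) (e : EulerAngles)
    (he : T.IsMotion J e)
    (τ : ℝ) (hτ : τ ∈ J) (E₀ K₀ r₀ : ℝ)
    (hE : T.energy e τ = E₀) (hK : T.verticalMomentum e τ = K₀) (hr : e.r τ = r₀)
    (s₁ s₂ s₃ : ℝ)
    (hs₁ : T.resolvent E₀ K₀ r₀ s₁ = 0) (hs₂ : T.resolvent E₀ K₀ r₀ s₂ = 0)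
    (hs₃ : T.resolvent E₀ K₀ r₀ s₃ = 0)
    (h₀₁ : -1 < s₁) (h₁₂ : s₁ < s₂) (h₂₁ : s₂ < 1) (h₁₃ : 1 < s₃) :
    -- The quadrature of the precession against the square root of the resolvent.
    (∀ α y : ℝ, s₁ ≤ y → y < s₂ →
      IntervalIntegrable
        (fun s => (1 - α * s) / ((1 - s ^ 2) * Real.sqrt ((s - s₁) * (s - s₂) * (s - s₃))))
        MeasureTheory.volume s₁ y ∧
      ∫ s in s₁..y, (1 - α * s) / ((1 - s ^ 2) * Real.sqrt ((s - s₁) * (s - s₂) * (s - s₃))) =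
        2 * Real.sqrt (y - s₁) / ((1 - s₁ ^ 2) * Real.sqrt ((s₃ - s₁) * (s₂ - s₁))) *
          ((1 - α * s₁) * lauricellaXi s₁ s₂ s₃ y -
            α / 3 * (y - s₁) * lauricellaLambda s₁ s₂ s₃ y)) ∧
    -- The precession angle while `cos θ` increases from its minimum `s₁`.
    (∀ t₀ ∈ J, ∀ t ∈ J, t₀ ≤ t → MonotoneOn (fun u => Real.cos (e.θ u)) (Set.Icc t₀ t) →
      Real.cos (e.θ t₀) = s₁ → Real.cos (e.θ t) < s₂ →
      e.ψ t - e.ψ t₀ =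
        2 * Real.sqrt (Real.cos (e.θ t) - s₁) /
            ((1 - s₁ ^ 2) * Real.sqrt ((s₃ - s₁) * (s₂ - s₁))) *
          ((T.kHat K₀ - T.cConst * T.lam r₀ * s₁) * lauricellaXi s₁ s₂ s₃ (Real.cos (e.θ t)) -
            T.cConst * T.lam r₀ / 3 * (Real.cos (e.θ t) - s₁) *
              lauricellaLambda s₁ s₂ s₃ (Real.cos (e.θ t)))) ∧
    -- Any initial position, `cos θ` increasing.
    (∀ t₀ ∈ J, ∀ t ∈ J, t₀ ≤ t → MonotoneOn (fun u => Real.cos (e.θ u)) (Set.Icc t₀ t) →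
      Real.cos (e.θ t) < s₂ →
      e.ψ t - e.ψ t₀ =
        precessionForm s₁ s₂ s₃ (T.kHat K₀) (T.cConst * T.lam r₀) (Real.cos (e.θ t)) -
          precessionForm s₁ s₂ s₃ (T.kHat K₀) (T.cConst * T.lam r₀) (Real.cos (e.θ t₀))) ∧
    -- Any initial position, `cos θ` decreasing.
    (∀ t₀ ∈ J, ∀ t ∈ J, t₀ ≤ t → AntitoneOn (fun u => Real.cos (e.θ u)) (Set.Icc t₀ t) →
      Real.cos (e.θ t₀) < s₂ →
      e.ψ t - e.ψ t₀ =
        -(precessionForm s₁ s₂ s₃ (T.kHat K₀) (T.cConst * T.lam r₀) (Real.cos (e.θ t)) -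
          precessionForm s₁ s₂ s₃ (T.kHat K₀) (T.cConst * T.lam r₀) (Real.cos (e.θ t₀)))) := by
  have h := he.isReducedMotion hJ hτ hE hK hr hs₁ hs₂ hs₃ h₁₂.ne (by linarith) (by linarith)
  have hρ := T.rhoHat_pos
  refine ⟨fun α y h₁ h₂ => ⟨intervalIntegrable_precessionKernel 1 α h₀₁ h₂₁ h₁₃ h₁ h₂,
    integral_precessionKernel 1 α h₀₁ h₁₂ h₂₁ h₁₃ h₁ h₂⟩, ?_, ?_, ?_⟩
  · intro t₀ ht₀ t ht hle hmono h0 hlt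
    refine (h.ψ_sub_eq_of_monotoneOn hρ h₀₁ h₁₂ h₂₁ h₁₃ hle (hJ.out ht₀ ht) hmono hlt).trans ?_
    -- The initial term vanishes through its factor `√(s₁ - s₁)`.
    simp only [h0, precessionForm, sub_self, Real.sqrt_zero, mul_zero, zero_div, zero_mul, sub_zero]
  · intro t₀ ht₀ t ht hle hmono hlt
    exact h.ψ_sub_eq_of_monotoneOn hρ h₀₁ h₁₂ h₂₁ h₁₃ hle (hJ.out ht₀ ht) hmono hlt
  · intro t₀ ht₀ t ht hle hanti hlt
    exact h.ψ_sub_eq_of_antitoneOn hρ h₀₁ h₁₂ h₂₁ h₁₃ hle (hJ.out ht₀ ht) hanti hlt
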